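/- A quantitative reachability game $\mathcal G$ consists of a finite set $\Pi$ of players, a finite set $V$ of vertices partitioned into sets $(V_i)_{i\in\Pi}$ ($V_i$ is controlled by player $i$; empty sets $V_i$ are allowed), a set $E\subseteq V\times V$ of edges such that every vertex has an outgoing edge, and a target set $T_i\subseteq V$ for each player $i$. A play is an infinite path $\rho=\rho_0\rho_1\ldots$, a history is a nonempty finite path; the cost $\lambda_i(\rho)\in\mathbb N\cup\{+\infty\}$ of player $i$ is the least $n$ with $\rho_n\in T_i$, and $+\infty$ if there is none. Fix an initial vertex $v_0$. A strategy $\sigma_i$ of player $i$ assigns to each history $hv$ that starts in $v_0$ and ends in a vertex $v\in V_i$ a successor of $v$; it is finite-memory if it is computed by a finite Moore machine reading the history. A strategy profile $\bar\sigma=(\sigma_i)_{i\in\Pi}$ is finite-memory if every $\sigma_i$ is, and its outcome is the unique play from the initial vertex that is consistent with all $\sigma_i$. It is a Nash equilibrium if no player can strictly decrease the cost of the outcome for himself by changing only his own strategy. It is a subgame perfect equilibrium (SPE) if for every history $hv$ starting in $v_0$ (with $h$ possibly empty) the restricted profile $h'\mapsto\bar\sigma(hh')$ is a Nash equilibrium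 in the game with initial vertex $v$ and costs $\rho\mapsto\lambda_i(h\rho)$. Theorem. Every quantitative reachability game $\mathcal G$ with initial vertex $v_0$ has a finite-memory SPE. Moreover there is an algorithm that, given a description of any such $(\mathcal G,v_0)$, halts and outputs finite Moore machines, one for each player, whose strategies form an SPE of $(\mathcal G,v_0)$. -/

import Mathlib

namespace QuantReach

universe u v

/-- The graph of a turn-based multiplayer game: players `P`, vertices `V`, every vertex `w` is
controlled by the player `owner w` (so the sets `V_i = {w | owner w = i}` partition `V`), and every
vertex has at least one outgoing edge. -/
structure Arena (P : Type u) (V : Type v) where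
  owner : V → P
  Edge : V → V → Prop
  exists_edge : ∀ w, ∃ w', Edge w w'

/-- A quantitative game: an arena together with a cost function with values in `ℝ ∪ {+∞}` for each
player. -/
structure QuantGame (P : Type u) (V : Type v) extends Arena P V where
  cost : P → (ℕ → V) → WithTop ℝ

/-- The concatenation `h ρ` of a finite sequence and an infinite sequence. -/
def concat {V : Type v} (h : List V) (ρ : ℕ → V) : ℕ → V :=
  fun n => h.getD n (ρ (n - h.length))

namespace Arena

variable {P : Type u} {V : Type v}

/-- `A.IsHistory v₀ h w` says that the nonempty sequence `h w` (a possibly empty sequence `h`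
followed by the last vertex `w`) is a history starting in `v₀`. -/
def IsHistory (A : Arena P V) (v₀ : V) (h : List V) (w : V) : Prop :=
  (h ++ [w]).IsChain A.Edge ∧ (h ++ [w]).head? = some v₀

theorem IsHistory.append {A : Arena P V} {v₀ w w' : V} {h h' : List V}
    (hh : A.IsHistory v₀ h w) (hh' : A.IsHistory w h' w') : A.IsHistory v₀ (h ++ h') w' := by
  obtain ⟨h1, h2⟩ := hh
  obtain ⟨h3, h4⟩ := hh'
  refine ⟨?_, ?_⟩
  · rw [List.append_assoc, List.isChain_append]
    rw [List.isChain_append] at h1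
    refine ⟨h1.1, h3, fun x hx y hy => h1.2.2 x hx y ?_⟩
    rw [h4] at hy
    simpa using hy
  · cases h with
    | nil =>
      simp only [List.nil_append, List.head?_cons, Option.some.injEq] at h2
      simpa [h2] using h4
    | cons a l => simpa using h2

/-- A strategy of player `i` in the game initialized at `v₀`: it assigns to each history `h w`
that starts in `v₀` and ends in a vertex `w` of player `i` a successor of `w`. (The values at other
arguments are irrelevant.) -/
structure Strategy (A : Arena P V) (v₀ : V) (i : P) where
  move : List V → V → V
  legal : ∀ h w, A.IsHistory v₀ h w → A.owner w = i → A.Edge w (move h w)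

/-- A strategy profile in the game initialized at `v₀`. -/
abbrev Profile (A : Arena P V) (v₀ : V) : Type (max u v) := ∀ i : P, A.Strategy v₀ i

/-- The outcome of a strategy profile: the play from `v₀` in which each next vertex is the one that
the strategy of the owner of the current vertex chooses. The recursion goes over pairs
`(h, w)` that stand for the current history `h w`. -/
def outcome (A : Arena P V) {v₀ : V} (σ : A.Profile v₀) : ℕ → V :=
  fun n => ((fun s : List V × V => (s.1 ++ [s.2], (σ (A.owner s.2)).move s.1 s.2))^[n] ([], v₀)).2

/-- The profile `(σ'_i, σ_{-i})`. -/
noncomputable def deviate (A : Arena P V) {v₀ : V} (σ : A.Profile v₀) (i : P)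
    (σ' : A.Strategy v₀ i) : A.Profile v₀ :=
  open Classical in Function.update σ i σ'

/-- The restriction of a strategy profile to the histories that extend `h w`. -/
def restrict (A : Arena P V) {v₀ : V} (σ : A.Profile v₀) (h : List V) (w : V)
    (hw : A.IsHistory v₀ h w) : A.Profile w :=
  fun i =>
    { move := fun h' w' => (σ i).move (h ++ h') w'
      legal := fun h' w' hh' ho => (σ i).legal (h ++ h') w' (hw.append hh') ho }

end Arena

namespace QuantGame

variable {P : Type u} {V : Type v}

/-- Nash equilibrium in the game `G` initialized at `v₀`. -/
def IsNash (G : QuantGame P V) (v₀ : V) (σ : G.toArena.Profile v₀) : Prop :=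
  ∀ (i : P) (σ' : G.toArena.Strategy v₀ i),
    G.cost i (G.toArena.outcome σ) ≤ G.cost i (G.toArena.outcome (G.toArena.deviate σ i σ'))

/-- The subgame after `h`: the same arena, with costs `ρ ↦ cost (h ρ)`. -/
def subgame (G : QuantGame P V) (h : List V) : QuantGame P V :=
  { G with cost := fun i ρ => G.cost i (concat h ρ) }

/-- Subgame perfect equilibrium in the game `G` initialized at `v₀`. -/
def IsSPE (G : QuantGame P V) (v₀ : V) (σ : G.toArena.Profile v₀) : Prop :=
  ∀ (h : List V) (w : V) (hw : G.toArena.IsHistory v₀ h w),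
    (G.subgame h).IsNash w (G.toArena.restrict σ h w hw)

end QuantGame

/-- A reachability game: each player has a target set of vertices. -/
structure ReachGame (P : Type u) (V : Type v) extends Arena P V where
  target : P → Set V

/-- The least index `n` with `ρ n ∈ T`, and `+∞` if there is none. -/
noncomputable def reachCost {V : Type v} (T : Set V) (ρ : ℕ → V) : ℕ∞ :=
  ⨅ (n : ℕ) (_ : ρ n ∈ T), (n : ℕ∞)

/-- The quantitative game in which the cost of each player is the number of edges until his target
set is reached (`ENat.map` maps `n` to the real number `n`, and `+∞` to `+∞`). -/
noncomputable def ReachGame.toQuantGame {P : Type u} {V : Type v} (G : ReachGame P V) :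
    QuantGame P V :=
  { G.toArena with cost := fun i ρ => ENat.map (fun n : ℕ => (n : ℝ)) (reachCost (G.target i) ρ) }

/-- A Moore machine that reads vertices and outputs a vertex, with set of states `M`. -/
structure MooreMachine (V : Type v) (M : Type) where
  init : M
  step : M → V → M
  out : M → V

/-- The machine implements the strategy: the move after the history `h w` is the output of the state
that is reached when the whole history `h w` has been read. -/
def MooreMachine.Implements {P : Type u} {V : Type v} {M : Type} (m : MooreMachine V M)
    {A : Arena P V} {v₀ : V} {i : P} (σ : A.Strategy v₀ i) : Prop :=
  ∀ h w, A.IsHistory v₀ h w → A.owner w = i →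
    σ.move h w = m.out ((h ++ [w]).foldl m.step m.init)

/-- A strategy profile is finite-memory if the strategy of each player is implemented by a finite
Moore machine. -/
def Arena.Profile.IsFiniteMemory {P : Type u} {V : Type v} {A : Arena P V} {v₀ : V}
    (σ : A.Profile v₀) : Prop :=
  ∀ i, ∃ (M : Type) (_ : Finite M) (m : MooreMachine V M), m.Implements (σ i)

/-- Finite descriptions of initialized reachability games: number of players, number of vertices,
list of the owners of the vertices, adjacency matrix, for each player the indicator list of his
target set, and initial vertex. -/
structure GameCode where
  players : ℕ
  vertices : ℕ
  owners : List ℕ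
  edges : List (List Bool)
  targets : List (List Bool)
  start : ℕ

/-- Finite descriptions of Moore machines: number of states, initial state, transition table (one
row for each state), and list of outputs. -/
structure MooreCode where
  states : ℕ
  init : ℕ
  step : List (List ℕ)
  out : List ℕ

/-- Game codes as tuples. -/
def GameCode.equiv :
    GameCode ≃ ℕ × ℕ × List ℕ × List (List Bool) × List (List Bool) × ℕ where
  toFun c := (c.players, c.vertices, c.owners, c.edges, c.targets, c.start)
  invFun t := ⟨t.1, t.2.1, t.2.2.1, t.2.2.2.1, t.2.2.2.2.1, t.2.2.2.2.2⟩
  left_inv _ := rfl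
  right_inv _ := rfl

/-- Machine codes as tuples. -/
def MooreCode.equiv : MooreCode ≃ ℕ × ℕ × List (List ℕ) × List ℕ where
  toFun c := (c.states, c.init, c.step, c.out)
  invFun t := ⟨t.1, t.2.1, t.2.2.1, t.2.2.2⟩
  left_inv _ := rfl
  right_inv _ := rfl

instance : Primcodable GameCode := Primcodable.ofEquiv _ GameCode.equiv

instance : Primcodable MooreCode := Primcodable.ofEquiv _ MooreCode.equiv

/-- The description of a reachability game on the players `0, …, p - 1` and the vertices
`0, …, n - 1`, with initial vertex `v₀`. -/
noncomputable def ReachGame.code {p n : ℕ} (G : ReachGame (Fin p) (Fin n)) (v₀ : Fin n) :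
    GameCode :=
  open Classical in
  { players := p
    vertices := n
    owners := List.ofFn fun w => (G.owner w : ℕ)
    edges := List.ofFn fun w => List.ofFn fun w' => decide (G.Edge w w')
    targets := List.ofFn fun i => List.ofFn fun w => decide (w ∈ G.target i)
    start := v₀ }

/-- The description of a Moore machine with states `0, …, k - 1` that reads and outputs vertices
`0, …, n - 1`. -/
def MooreMachine.code {n k : ℕ} (m : MooreMachine (Fin n) (Fin k)) : MooreCode :=
  { states := k
    init := m.init
    step := List.ofFn fun q => List.ofFn fun w => (m.step q w : ℕ)
    out := List.ofFn fun q => (m.out q : ℕ) }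

/-- `ConstructsSPE f`: for every initialized reachability game on numbered players and vertices, the
partial function `f` is defined at the description of the game, and its value there is the list of
the descriptions of finite Moore machines, one for each player, that implement an SPE. -/
def ConstructsSPE (f : GameCode →. List MooreCode) : Prop :=
  ∀ (p n : ℕ) (G : ReachGame (Fin p) (Fin n)) (v₀ : Fin n),
    ∃ (k : Fin p → ℕ) (m : ∀ i, MooreMachine (Fin n) (Fin (k i)))
      (σ : G.toQuantGame.toArena.Profile v₀),
      (List.ofFn fun i => (m i).code) ∈ f (G.code v₀) ∧
      (∀ i, (m i).Implements (σ i)) ∧ G.toQuantGame.IsSPE v₀ σ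

end QuantReach

/-! ### Histories and outcomes, step by step -/

namespace QuantReach

universe u v

namespace Arena

variable {P : Type u} {V : Type v}

/-! All players run one machine whose state determines the current vertex and, for each player, the
time he still needs, `0` once his target has been visited. Suppose that this time drops by exactly
one (truncated at `0`) under the machine's own move, and by at most one for the owner of the vertex
under any of his moves. Then no deviation pays after any history: one that succeeds within `k` steps
forces the time at its start to be at most `k`, and the prescribed play succeeds within `k` steps as
well. These conditions are local; see `IsCertificate.isSPE_profile`.

Such a machine comes from backward induction on pairs (vertex, set of players already served). The
value tables for growing horizon live in a compact power of `ℕ∞`, and "is a backup of" is a closed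
relation, so every cluster point is a backup of another cluster point (`exists_isCompact_isBackup`).
After a deviation the play switches to the cluster point that is worst for the deviator at the
vertex reached; the maximum exists by compactness. Only finitely many punishments are needed, and
along prescribed moves finite entries never grow, so finitely many vectors of times suffice as
states (`exists_finite_coherent`).

For the algorithm, checking a coded certificate is primitive recursive. A search through all codes
halts because a certificate exists, and whatever it finds is correct. -/

theorem isHistory_nil {A : Arena P V} {v₀ w : V} : A.IsHistory v₀ [] w ↔ w = v₀ := by
  simp [IsHistory]

theorem isHistory_concat {A : Arena P V} {v₀ u w : V} {h : List V} :
    A.IsHistory v₀ (h ++ [u]) w ↔ A.IsHistory v₀ h u ∧ A.Edge u w := by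
  unfold IsHistory
  rw [List.isChain_append (l₁ := h ++ [u]) (l₂ := [w])]
  have : (h ++ [u] ++ [w]).head? = (h ++ [u]).head? := by cases h <;> simp
  rw [this]
  simp
  tauto

/-- The history of length `n + 1` of the outcome of a profile, as a pair of its initial part and
its last vertex. -/
def path (A : Arena P V) {v₀ : V} (σ : A.Profile v₀) (n : ℕ) : List V × V :=
  (fun s : List V × V => (s.1 ++ [s.2], (σ (A.owner s.2)).move s.1 s.2))^[n] ([], v₀)

theorem path_zero (A : Arena P V) {v₀ : V} (σ : A.Profile v₀) : A.path σ 0 = ([], v₀) := rfl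

theorem path_succ (A : Arena P V) {v₀ : V} (σ : A.Profile v₀) (n : ℕ) :
    A.path σ (n + 1) = ((A.path σ n).1 ++ [(A.path σ n).2],
      (σ (A.owner (A.path σ n).2)).move (A.path σ n).1 (A.path σ n).2) := by
  simp only [path, Function.iterate_succ_apply']

theorem outcome_eq_path (A : Arena P V) {v₀ : V} (σ : A.Profile v₀) (n : ℕ) :
    A.outcome σ n = (A.path σ n).2 := rfl

theorem isHistory_path (A : Arena P V) {v₀ : V} (σ : A.Profile v₀) (n : ℕ) :
    A.IsHistory v₀ (A.path σ n).1 (A.path σ n).2 := by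
  induction n with
  | zero => exact isHistory_nil.2 rfl
  | succ n ih =>
    rw [path_succ]
    exact isHistory_concat.2 ⟨ih, (σ _).legal _ _ ih rfl⟩

theorem deviate_of_ne (A : Arena P V) {v₀ : V} (σ : A.Profile v₀) {i j : P}
    (σ' : A.Strategy v₀ i) (h : j ≠ i) : A.deviate σ i σ' j = σ j := by
  classical
  exact Function.update_of_ne h _ _

theorem exists_outcome_of_mem_path (A : Arena P V) {v₀ x : V} (σ : A.Profile v₀) {n : ℕ}
    (hx : x ∈ (A.path σ n).1 ++ [(A.path σ n).2]) : ∃ j ≤ n, A.outcome σ j = x := by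
  induction n with
  | zero => exact ⟨0, le_rfl, by simpa [path_zero, outcome_eq_path, eq_comm] using hx⟩
  | succ n ih =>
    rw [List.mem_append] at hx
    rcases hx with hx | hx
    · rw [path_succ] at hx
      obtain ⟨j, hj, e⟩ := ih hx
      exact ⟨j, hj.trans n.le_succ, e⟩
    · exact ⟨n + 1, le_rfl, (List.mem_singleton.1 hx).symm⟩

end Arena

theorem reachCost_le_of_forall_exists {V : Type v} {T : Set V} {ρ ρ' : ℕ → V}
    (H : ∀ n, ρ' n ∈ T → ∃ m ≤ n, ρ m ∈ T) : reachCost T ρ ≤ reachCost T ρ' := by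
  refine le_iInf₂ fun n hn => ?_
  obtain ⟨m, hm, hT⟩ := H n hn
  exact (iInf₂_le m hT).trans (by exact_mod_cast hm)

theorem ReachGame.cost_le_of_reachCost_le {P : Type u} {V : Type v} (G : ReachGame P V) {i : P}
    {ρ ρ' : ℕ → V} (H : reachCost (G.target i) ρ ≤ reachCost (G.target i) ρ') :
    G.toQuantGame.cost i ρ ≤ G.toQuantGame.cost i ρ' := by
  change ENat.map _ _ ≤ ENat.map _ _
  exact WithTop.monotone_map_iff.2 Nat.mono_cast H

theorem concat_of_lt {V : Type v} {h : List V} {ρ : ℕ → V} {n : ℕ} (hn : n < h.length) :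
    concat h ρ n = h[n] := by
  simp [concat, hn]

theorem concat_length_add {V : Type v} {h : List V} {ρ : ℕ → V} {n : ℕ} :
    concat h ρ (h.length + n) = ρ n := by
  simp [concat]

/-! ### Local certificates and why they give equilibria -/

/-- The state of the machine after reading `h w`. -/
def MooreMachine.read {V : Type v} {M : Type} (m : MooreMachine V M) (h : List V) (w : V) : M :=
  (h ++ [w]).foldl m.step m.init

theorem MooreMachine.read_concat {V : Type v} {M : Type} (m : MooreMachine V M) (h : List V)
    (u w : V) : m.read (h ++ [u]) w = m.step (m.read h u) w := by
  simp [MooreMachine.read]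

/-- A local certificate that the machine `m`, used by all players, implements a subgame perfect
equilibrium: `lab q` is the last vertex that has been read, and `val q i` is the time that player
`i` still needs (`0` iff his target set has already been visited). -/
structure IsCertificate {P : Type u} {V : Type v} (G : ReachGame P V) (v₀ : V) {M : Type}
    (m : MooreMachine V M) (good : Set M) (lab : M → V) (val : M → P → ℕ∞) : Prop where
  start_mem : m.step m.init v₀ ∈ good
  lab_start : lab (m.step m.init v₀) = v₀
  val_start : ∀ i, val (m.step m.init v₀) i = 0 ↔ v₀ ∈ G.target i
  edge_out : ∀ q ∈ good, G.Edge (lab q) (m.out q)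
  step_mem : ∀ q ∈ good, ∀ w, G.Edge (lab q) w → m.step q w ∈ good
  lab_step : ∀ q ∈ good, ∀ w, G.Edge (lab q) w → lab (m.step q w) = w
  val_step : ∀ q ∈ good, ∀ w, G.Edge (lab q) w → ∀ i,
    (val (m.step q w) i = 0 ↔ val q i = 0 ∨ w ∈ G.target i)
  val_out : ∀ q ∈ good, ∀ i, val (m.step q (m.out q)) i = val q i - 1
  val_le : ∀ q ∈ good, ∀ w, G.Edge (lab q) w →
    val q (G.owner (lab q)) ≤ val (m.step q w) (G.owner (lab q)) + 1

namespace IsCertificate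

variable {P : Type u} {V : Type v} {G : ReachGame P V} {v₀ : V} {M : Type}
  {m : MooreMachine V M} {good : Set M} {lab : M → V} {val : M → P → ℕ∞}

/-- Ties the local data to the actual history: edges keep the state in `good`, and the zeros of
`val` record exactly the visited targets. -/
theorem read_spec (C : IsCertificate G v₀ m good lab val) {h : List V} {w : V}
    (hw : G.toArena.IsHistory v₀ h w) :
    m.read h w ∈ good ∧ lab (m.read h w) = w ∧
      ∀ i, val (m.read h w) i = 0 ↔ ∃ x ∈ h ++ [w], x ∈ G.target i := by
  induction h using List.reverseRecOn generalizing w with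
  | nil =>
    obtain rfl := Arena.isHistory_nil.1 hw
    exact ⟨C.start_mem, C.lab_start, fun i => by simpa [MooreMachine.read] using C.val_start i⟩
  | append_singleton h u ih =>
    obtain ⟨hu, he⟩ := Arena.isHistory_concat.1 hw
    obtain ⟨h1, h2, h3⟩ := ih hu
    rw [MooreMachine.read_concat]
    rw [← h2] at he
    refine ⟨C.step_mem _ h1 _ he, C.lab_step _ h1 _ he, fun i => ?_⟩
    rw [C.val_step _ h1 _ he, h3]
    constructor
    · rintro (⟨x, hx, hT⟩ | hT)
      · exact ⟨x, List.mem_append_left _ hx, hT⟩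
      · exact ⟨w, by simp, hT⟩
    · rintro ⟨x, hx, hT⟩
      rcases List.mem_append.1 hx with hx | hx
      · exact Or.inl ⟨x, hx, hT⟩
      · exact Or.inr (by simpa using (List.mem_singleton.1 hx) ▸ hT)

/-- The profile in which every player uses the machine of the certificate. -/
def profile (C : IsCertificate G v₀ m good lab val) : G.toQuantGame.toArena.Profile v₀ :=
  fun _ =>
    { move := fun h w => m.out (m.read h w)
      legal := fun h w hw _ => by
        obtain ⟨h1, h2, -⟩ := C.read_spec hw
        have := C.edge_out _ h1
        rwa [h2] at this }

theorem implements_profile (C : IsCertificate G v₀ m good lab val) (i : P) :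
    m.Implements (C.profile i) :=
  fun _ _ _ _ => rfl

theorem isSPE_profile (C : IsCertificate G v₀ m good lab val) :
    G.toQuantGame.IsSPE v₀ C.profile := by
  intro h w hw i σ'
  set A := G.toQuantGame.toArena with hA
  set τ : A.Profile w := A.restrict C.profile h w hw with hτ
  set τ' : A.Profile w := A.deviate τ i σ' with hτ'
  have read_path (θ : A.Profile w) (n : ℕ) := C.read_spec (hw.append (A.isHistory_path θ n))
  have read_succ (θ : A.Profile w) (n : ℕ) :
      m.read (h ++ (A.path θ (n + 1)).1) (A.path θ (n + 1)).2 =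
        m.step (m.read (h ++ (A.path θ n).1) (A.path θ n).2) (A.path θ (n + 1)).2 := by
    rw [A.path_succ, ← List.append_assoc, MooreMachine.read_concat]
  have edge (θ : A.Profile w) (n : ℕ) : G.Edge (A.path θ n).2 (A.path θ (n + 1)).2 := by
    rw [A.path_succ]
    exact (θ _).legal _ _ (A.isHistory_path θ n) rfl
  -- Under `τ` every move is the machine's output, so the time decreases by one per step, with
  -- truncated subtraction.
  have val_outcome (n : ℕ) : val (m.read (h ++ (A.path τ n).1) (A.path τ n).2) i =
      val (m.read h w) i - n := by
    induction n with
    | zero => simp [Arena.path_zero]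
    | succ n ih =>
      rw [read_succ]
      have hm : (A.path τ (n + 1)).2 = m.out (m.read (h ++ (A.path τ n).1) (A.path τ n).2) := by
        rw [A.path_succ]; rfl
      rw [hm, C.val_out _ (read_path τ n).1, ih]
      push_cast
      rw [tsub_tsub]
  -- Under `τ'` the time of `i` drops by at most one per step: by `val_le` where `i` moves, and by
  -- `val_out` elsewhere, since the other players still follow the machine.
  have val_deviate (n : ℕ) : val (m.read h w) i ≤
      val (m.read (h ++ (A.path τ' n).1) (A.path τ' n).2) i + n := by
    induction n with
    | zero => simp [Arena.path_zero]
    | succ n ih =>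
      refine ih.trans ?_
      obtain ⟨h1, h2, -⟩ := read_path τ' n
      have key : val (m.read (h ++ (A.path τ' n).1) (A.path τ' n).2) i ≤
          val (m.read (h ++ (A.path τ' (n + 1)).1) (A.path τ' (n + 1)).2) i + 1 := by
        rw [read_succ]
        by_cases ho : A.owner (A.path τ' n).2 = i
        · have := C.val_le _ h1 _ (h2.symm ▸ edge τ' n)
          rw [h2] at this
          rw [← ho]
          exact this
        · have hm : (A.path τ' (n + 1)).2 =
              m.out (m.read (h ++ (A.path τ' n).1) (A.path τ' n).2) := by
            rw [A.path_succ]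
            change (τ' _).move _ _ = _
            rw [hτ', A.deviate_of_ne τ σ' ho]
            rfl
          rw [hm, C.val_out _ h1]
          exact le_tsub_add
      calc _ ≤ val (m.read (h ++ (A.path τ' (n + 1)).1) (A.path τ' (n + 1)).2) i + 1 + n := by
            gcongr
        _ = _ := by push_cast; ring
  refine G.cost_le_of_reachCost_le (reachCost_le_of_forall_exists fun n hn => ?_)
  -- Subgame costs also count the prefix `h`; a visit inside `h` is common to both plays.
  rcases lt_or_ge n h.length with hlt | hge
  · refine ⟨n, le_rfl, ?_⟩
    rw [concat_of_lt hlt] at hn ⊢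
    exact hn
  · obtain ⟨k, rfl⟩ := Nat.exists_eq_add_of_le hge
    rw [concat_length_add] at hn
    change (A.path τ' k).2 ∈ G.target i at hn
    have h0 : val (m.read (h ++ (A.path τ' k).1) (A.path τ' k).2) i = 0 :=
      ((read_path τ' k).2.2 i).2 ⟨_, by simp, hn⟩
    have h1 : val (m.read h w) i ≤ k := by simpa [h0] using val_deviate k
    have h2 : val (m.read (h ++ (A.path τ k).1) (A.path τ k).2) i = 0 := by
      rw [val_outcome, tsub_eq_zero_of_le h1]
    -- Time `0` only says that the target occurs somewhere in what has been read, possibly already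
    -- in `h`.
    obtain ⟨x, hx, hT⟩ := ((read_path τ k).2.2 i).1 h2
    rw [List.append_assoc, List.mem_append] at hx
    rcases hx with hx | hx
    · obtain ⟨j, hj, rfl⟩ := List.getElem_of_mem hx
      exact ⟨j, by omega, by rwa [concat_of_lt hj]⟩
    · obtain ⟨j, hj, rfl⟩ := A.exists_outcome_of_mem_path τ hx
      exact ⟨h.length + j, by omega, by rwa [concat_length_add]⟩

end IsCertificate

end QuantReach

/-! ### Existence of finite certificates: backward induction and compactness -/

namespace QuantReach

universe u v

open Filter Topology

variable {P : Type u} {V : Type v}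

namespace ReachGame

/-- Move to the vertex `w` in the extended arena, in which a vertex is paired with the set of the
players who have already visited their target sets. -/
def extNext (G : ReachGame P V) (s : V × Set P) (w : V) : V × Set P :=
  (w, s.2 ∪ {i | w ∈ G.target i})

/-- `W` arises from `W'` by one step of backward induction in the extended arena. -/
def IsBackup (G : ReachGame P V) (W W' : V × Set P → P → ℕ∞) : Prop :=
  ∃ g : V × Set P → V, ∀ s, G.Edge s.1 (g s) ∧
    (∀ w, G.Edge s.1 w →
      W' (G.extNext s (g s)) (G.owner s.1) ≤ W' (G.extNext s w) (G.owner s.1)) ∧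
    (∀ i ∈ s.2, W s i = 0) ∧ ∀ i ∉ s.2, W s i = W' (G.extNext s (g s)) i + 1

theorem exists_isBackup (G : ReachGame P V) (W' : V × Set P → P → ℕ∞) :
    ∃ W, G.IsBackup W W' := by
  classical
  have H (s : V × Set P) : ∃ w, G.Edge s.1 w ∧ ∀ w', G.Edge s.1 w' →
      W' (G.extNext s w) (G.owner s.1) ≤ W' (G.extNext s w') (G.owner s.1) := by
    obtain ⟨w, hw, hmin⟩ := (InvImage.wf (fun w => W' (G.extNext s w) (G.owner s.1))
      (wellFounded_lt (α := ℕ∞))).has_min {w | G.Edge s.1 w} (G.exists_edge s.1)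
    exact ⟨w, hw, fun w' hw' => not_lt.1 (hmin w' hw')⟩
  choose g hg hmin using H
  refine ⟨fun s i => if i ∈ s.2 then 0 else W' (G.extNext s (g s)) i + 1, g, fun s => ?_⟩
  exact ⟨hg s, hmin s, fun i hi => if_pos hi, fun i hi => if_neg hi⟩

/-- The entry of a player not yet served has the form `x + 1`, hence is nonzero. Nothing is assumed
about `W'`, so this holds even when `W'` is `⊤` everywhere. -/
theorem IsBackup.eq_zero_iff {G : ReachGame P V} {W W' : V × Set P → P → ℕ∞}
    (h : G.IsBackup W W') (s : V × Set P) (i : P) : W s i = 0 ↔ i ∈ s.2 := by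
  obtain ⟨g, hg⟩ := h
  refine ⟨fun h0 => ?_, (hg s).2.2.1 i⟩
  by_contra hi
  rw [(hg s).2.2.2 i hi] at h0
  simp at h0

/-- For a fixed choice function `g` the conditions are equalities and non-strict inequalities
between continuous functions, and there are only finitely many `g`. -/
theorem isClosed_isBackup [Finite P] [Finite V] (G : ReachGame P V) :
    IsClosed {p : (V × Set P → P → ℕ∞) × (V × Set P → P → ℕ∞) | G.IsBackup p.1 p.2} := by
  have c1 (s : V × Set P) (i : P) : Continuous
      fun p : (V × Set P → P → ℕ∞) × (V × Set P → P → ℕ∞) => p.1 s i := by fun_prop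
  have c2 (s : V × Set P) (i : P) : Continuous
      fun p : (V × Set P → P → ℕ∞) × (V × Set P → P → ℕ∞) => p.2 s i := by fun_prop
  simp only [IsBackup, Set.ofPred_exists, Set.ofPred_forall, Set.ofPred_and]
  refine isClosed_iUnion_of_finite fun g => isClosed_iInter fun s => ?_
  refine isClosed_const.inter (IsClosed.inter ?_ (IsClosed.inter ?_ ?_))
  · exact isClosed_iInter fun w => isClosed_iInter fun _ => isClosed_le (c2 _ _) (c2 _ _)
  · exact isClosed_iInter fun i => isClosed_iInter fun _ => isClosed_eq (c1 _ _) continuous_const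
  · exact isClosed_iInter fun i => isClosed_iInter fun _ =>
      isClosed_eq (c1 _ _) ((c2 _ _).add continuous_const)

/-- The cluster points of backward induction with growing horizon are closed under taking
predecessors. -/
theorem exists_isCompact_isBackup [Finite P] [Finite V] (G : ReachGame P V) :
    ∃ K : Set (V × Set P → P → ℕ∞), IsCompact K ∧ K.Nonempty ∧
      ∀ W ∈ K, ∃ W' ∈ K, G.IsBackup W W' := by
  choose F hF using G.exists_isBackup
  -- Backward induction with horizon `n`, all times being infinite at the horizon. Convergence of
  -- `Z` is not needed.
  set Z : ℕ → V × Set P → P → ℕ∞ := fun n => F^[n] fun _ _ => ⊤ with hZ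
  have hZs (n : ℕ) : G.IsBackup (Z (n + 1)) (Z n) := by
    simp only [hZ, Function.iterate_succ_apply']
    exact hF _
  refine ⟨{W | MapClusterPt W atTop Z},
    (isClosed_setOfPred_clusterPt (f := map Z atTop)).isCompact, ?_, ?_⟩
  · obtain ⟨W, -, hW⟩ := isCompact_univ (X := V × Set P → P → ℕ∞)
      (f := map Z atTop) (by simp)
    exact ⟨W, hW⟩
  · intro W hW
    -- Along one ultrafilter both `Z n` and the shifted `Z (n - 1)` converge, so the closed relation
    -- passes to the pair of limits; `n = 0` is eventually excluded.
    obtain ⟨U, hU, hUW⟩ := mapClusterPt_iff_ultrafilter.1 hW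
    set Z' : ℕ → V × Set P → P → ℕ∞ := fun n => Z (n - 1) with hZ'
    obtain ⟨W', -, hW'⟩ := isCompact_univ.ultrafilter_le_nhds (U.map Z') (by simp)
    have hUW' : Tendsto Z' U (𝓝 W') := hW'
    refine ⟨W', ?_, ?_⟩
    · have : MapClusterPt W' U Z' := hUW'.mapClusterPt
      have h1 : Tendsto (fun n : ℕ => n - 1) U atTop := (tendsto_sub_atTop_nat 1).mono_left hU
      exact MapClusterPt.of_comp h1 this
    · refine G.isClosed_isBackup.mem_of_tendsto (hUW.prodMk_nhds hUW') ?_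
      filter_upwards [hU (eventually_ge_atTop 1)] with n hn
      obtain ⟨k, rfl⟩ := Nat.exists_eq_add_of_le' hn
      exact hZs k

/-- A finite set of extended vertices, each with a vector of remaining times, that is closed under
a continuation of the play and under punishments of deviations. -/
theorem exists_finite_coherent [Finite P] [Finite V] (G : ReachGame P V) (s₀ : V × Set P) :
    ∃ Q : Set ((V × Set P) × (P → ℕ∞)), Q.Finite ∧ (∃ c, (s₀, c) ∈ Q) ∧
      (∀ y ∈ Q, ∀ i, y.2 i = 0 ↔ i ∈ y.1.2) ∧
      (∀ y ∈ Q, ∃ w, G.Edge y.1.1 w ∧ (G.extNext y.1 w, fun i => y.2 i - 1) ∈ Q) ∧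
      ∀ y ∈ Q, ∀ w, G.Edge y.1.1 w → ∃ c, (G.extNext y.1 w, c) ∈ Q ∧
        y.2 (G.owner y.1.1) ≤ c (G.owner y.1.1) + 1 := by
  obtain ⟨K, hK, hne, hpred⟩ := G.exists_isCompact_isBackup
  -- `M i s` will be the harshest punishment of `i` available from `s`.
  have hmax (i : P) (s : V × Set P) : ∃ W ∈ K, ∀ W' ∈ K, W' s i ≤ W s i :=
    hK.exists_isMaxOn hne (f := fun W => W s i) (by fun_prop)
  choose M hMK hM using hmax
  -- `K` may be infinite. Restricting to vectors with entries in `{0, …, B, ⊤}` makes `Q` finite,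
  -- yet keeps all punishments and is stable under subtracting `1`.
  obtain ⟨B, hB⟩ : ∃ B : ℕ, ∀ i s j, M i s s j = ⊤ ∨ M i s s j ≤ B := by
    obtain ⟨B, hB⟩ := (Set.finite_range
      fun t : P × (V × Set P) × P => (M t.1 t.2.1 t.2.1 t.2.2).toNat).bddAbove
    refine ⟨B, fun i s j => or_iff_not_imp_left.2 fun h => ?_⟩
    rw [← ENat.natCast_toNat h]
    exact_mod_cast hB ⟨(i, s, j), rfl⟩
  have hfin : {x : ℕ∞ | x = ⊤ ∨ x ≤ B}.Finite := by
    refine ((Set.finite_singleton ⊤).union ((Set.finite_Iic B).image Nat.cast)).subset ?_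
    rintro x (hx | hx)
    · exact Or.inl hx
    · obtain ⟨n, rfl⟩ := ENat.ne_top_iff_exists.1 (ne_top_of_le_ne_top (ENat.natCast_ne_top B) hx)
      exact Or.inr ⟨n, by simpa using hx, rfl⟩
  have hMQ (i : P) (s : V × Set P) : (∃ W ∈ K, W s = M i s s) ∧
      ∀ j, M i s s j ∈ {x : ℕ∞ | x = ⊤ ∨ x ≤ B} := ⟨⟨_, hMK i s, rfl⟩, hB i s⟩
  refine ⟨{y | (∃ W ∈ K, W y.1 = y.2) ∧ ∀ j, y.2 j ∈ {x : ℕ∞ | x = ⊤ ∨ x ≤ B}},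
    ?_, ⟨_, hMQ (G.owner s₀.1) s₀⟩, ?_, ?_, ?_⟩
  · refine (Set.finite_univ.prod (Set.Finite.pi' fun _ : P => hfin)).subset ?_
    exact fun y hy => ⟨Set.mem_univ _, hy.2⟩
  · rintro ⟨s, c⟩ ⟨⟨W, hW, hWs⟩, -⟩ i
    obtain rfl : W s = c := hWs
    obtain ⟨W', -, h⟩ := hpred W hW
    exact h.eq_zero_iff s i
  · rintro ⟨s, c⟩ ⟨⟨W, hW, hWs⟩, hc⟩
    obtain rfl : W s = c := hWs
    obtain ⟨W', hW', g, hg⟩ := hpred W hW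
    obtain ⟨h1, -, h3, h4⟩ := hg s
    refine ⟨g s, h1, ⟨W', hW', funext fun i => ?_⟩, fun i => ?_⟩
    · by_cases hi : i ∈ s.2
      · obtain ⟨W'', -, h⟩ := hpred W' hW'
        have : W' (G.extNext s (g s)) i = 0 := (h.eq_zero_iff _ i).2 (Or.inl hi)
        simp [h3 i hi, this]
      · simp only [h4 i hi]
        exact ((ENat.addLECancellable_of_ne_top ENat.one_ne_top).add_tsub_cancel_right).symm
    · rcases hc i with h | h
      · exact Or.inl (by simp [show W s i = ⊤ from h])
      · exact Or.inr (tsub_le_self.trans h)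
  · rintro ⟨s, c⟩ ⟨⟨W, hW, hWs⟩, -⟩ w hw
    obtain rfl : W s = c := hWs
    obtain ⟨W', hW', g, hg⟩ := hpred W hW
    obtain ⟨-, h2, h3, h4⟩ := hg s
    refine ⟨_, hMQ (G.owner s.1) (G.extNext s w), ?_⟩
    by_cases hi : G.owner s.1 ∈ s.2
    · simp [h3 _ hi]
    · simp only [h4 _ hi]
      gcongr
      -- Under `W'` the deviation is no better than the prescribed move, and the punishment is at
      -- least as bad for the deviator as `W'`.
      exact (h2 w hw).trans (hM _ _ _ hW')

/-- Every initialized reachability game with finitely many players and vertices has a certificate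
with finitely many states. -/
theorem exists_isCertificate [Finite P] [Finite V] (G : ReachGame P V) (v₀ : V) :
    ∃ (k : ℕ) (m : MooreMachine V (Fin (k + 1))) (lab : Fin (k + 1) → V)
      (val : Fin (k + 1) → P → ℕ∞), m.init = Fin.last k ∧
        IsCertificate G v₀ m {q | (q : ℕ) < k} lab val := by
  classical
  obtain ⟨Q, hQ, ⟨c₀, h₀⟩, hzero, hnext, hdev⟩ :=
    G.exists_finite_coherent (v₀, {i | v₀ ∈ G.target i})
  obtain ⟨k, ⟨e⟩⟩ := hQ.exists_equiv_fin
  have hnext' (y : Q) : ∃ w, G.Edge y.1.1.1 w ∧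
      ∃ z : Q, z.1 = (G.extNext y.1.1 w, fun i => y.1.2 i - 1) :=
    (hnext y.1 y.2).imp fun w h => ⟨h.1, ⟨_, h.2⟩, rfl⟩
  choose out hout nxt hnxt using hnext'
  -- The prescribed move must lead to the continuation `nxt y`, any other edge to a punishment;
  -- non-edges get the dummy value `y`.
  have hstep (y : Q) (w : V) : ∃ z : Q, (G.Edge y.1.1.1 w → z.1.1 = G.extNext y.1.1 w ∧
      y.1.2 (G.owner y.1.1.1) ≤ z.1.2 (G.owner y.1.1.1) + 1) ∧ (w = out y → z = nxt y) := by
    by_cases hw : w = out y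
    · refine ⟨nxt y, fun _ => ?_, fun _ => rfl⟩
      rw [hnxt, hw]
      exact ⟨rfl, le_tsub_add⟩
    · by_cases he : G.Edge y.1.1.1 w
      · obtain ⟨c, hc, hle⟩ := hdev y.1 y.2 w he
        exact ⟨⟨_, hc⟩, fun _ => ⟨rfl, hle⟩, fun h => absurd h hw⟩
      · exact ⟨y, fun h => absurd h he, fun h => absurd h hw⟩
  choose stp hstp hstp_out using hstep
  let y₀ : Q := ⟨_, h₀⟩
  -- The states below `k` enumerate `Q`. `Fin.last k` is the state before anything is read; its
  -- output, label and times are dummies.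
  let m : MooreMachine V (Fin (k + 1)) :=
    { init := Fin.last k
      step := fun q w => Fin.lastCases (motive := fun _ => Fin (k + 1)) (e y₀).castSucc
        (fun q => (e (stp (e.symm q) w)).castSucc) q
      out := fun q => Fin.lastCases (motive := fun _ => V) v₀ (fun q => out (e.symm q)) q }
  let lab : Fin (k + 1) → V :=
    fun q => Fin.lastCases (motive := fun _ => V) v₀ (fun q => (e.symm q).1.1.1) q
  let val : Fin (k + 1) → P → ℕ∞ :=
    fun q => Fin.lastCases (motive := fun _ => P → ℕ∞) (fun _ => 0) (fun q => (e.symm q).1.2) q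
  have step_last (w : V) : m.step (Fin.last k) w = (e y₀).castSucc := by simp [m]
  have step_cast (y : Q) (w : V) : m.step (e y).castSucc w = (e (stp y w)).castSucc := by simp [m]
  have out_cast (y : Q) : m.out (e y).castSucc = out y := by simp [m]
  have lab_cast (y : Q) : lab (e y).castSucc = y.1.1.1 := by simp [lab]
  have val_cast (y : Q) : val (e y).castSucc = y.1.2 := by simp [val]
  have good (q : Fin (k + 1)) (hq : q ∈ {q : Fin (k + 1) | (q : ℕ) < k}) :
      ∃ y, q = (e y).castSucc := ⟨e.symm (q.castLT hq), by simp⟩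
  refine ⟨k, m, lab, val, rfl, ?_⟩
  have hinit : m.step m.init v₀ = (e y₀).castSucc := step_last v₀
  constructor
  · rw [hinit]; simp
  · rw [hinit, lab_cast]
  · intro i
    rw [hinit, val_cast, hzero _ y₀.2]
    rfl
  · intro q hq
    obtain ⟨y, rfl⟩ := good q hq
    rw [lab_cast, out_cast]
    exact hout y
  · intro q hq w _
    obtain ⟨y, rfl⟩ := good q hq
    rw [step_cast]; simp
  · intro q hq w he
    obtain ⟨y, rfl⟩ := good q hq
    rw [lab_cast] at he
    rw [step_cast, lab_cast, (hstp y w he).1]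
    rfl
  · intro q hq w he i
    obtain ⟨y, rfl⟩ := good q hq
    rw [lab_cast] at he
    rw [step_cast, val_cast, val_cast, hzero _ (stp y w).2, hzero _ y.2, (hstp y w he).1]
    rfl
  · intro q hq i
    obtain ⟨y, rfl⟩ := good q hq
    rw [out_cast, step_cast, val_cast, val_cast, hstp_out y _ rfl, hnxt]
  · intro q hq w he
    obtain ⟨y, rfl⟩ := good q hq
    rw [lab_cast] at he ⊢
    rw [step_cast, val_cast, val_cast]
    exact (hstp y w he).2

theorem exists_finiteMemory_isSPE [Finite P] [Finite V] (G : ReachGame P V) (v₀ : V) :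
    ∃ σ : G.toQuantGame.toArena.Profile v₀,
      σ.IsFiniteMemory ∧ G.toQuantGame.IsSPE v₀ σ := by
  obtain ⟨k, m, lab, val, -, C⟩ := G.exists_isCertificate v₀
  exact ⟨C.profile, fun i => ⟨_, inferInstance, m, C.implements_profile i⟩, C.isSPE_profile⟩

end ReachGame

end QuantReach

/-! ### Coded certificates and their validity -/

namespace QuantReach

/-- Code `n < ∞` by `n + 1` and `∞` by `0`: the decoding function. -/
def decodeTime (a : ℕ) : ℕ∞ := if a = 0 then ⊤ else ((a - 1 : ℕ) : ℕ∞)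

/-- The predecessor of a coded time. -/
def predTime (a : ℕ) : ℕ := if a ≤ 1 then a else a - 1

theorem decodeTime_surjective : Function.Surjective decodeTime := fun x => by
  induction x using ENat.recTopCoe with
  | top => exact ⟨0, rfl⟩
  | coe n => exact ⟨n + 1, by simp [decodeTime]⟩

theorem decodeTime_injective : Function.Injective decodeTime := by
  intro a b h
  rcases a with - | a <;> rcases b with - | b <;> simp_all [decodeTime]

theorem decodeTime_eq_zero_iff {a : ℕ} : decodeTime a = 0 ↔ a = 1 :=
  decodeTime_injective.eq_iff' (by simp [decodeTime])

/-- The codes `0` (for `∞`) and `1` (for time `0`) are the fixed points of the truncated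
predecessor. -/
theorem decodeTime_predTime (a : ℕ) : decodeTime (predTime a) = decodeTime a - 1 := by
  match a with
  | 0 => rfl
  | 1 => simp [decodeTime, predTime]
  | a + 2 =>
    simp only [decodeTime, predTime, Nat.add_eq_zero_iff, OfNat.ofNat_ne_zero, and_false,
      if_false, show ¬ a + 2 ≤ 1 by omega, show ¬ a + 2 - 1 = 0 by omega]
    norm_cast

/-- The order of codes is not that of times, because `∞` has the least code; hence the cases. -/
theorem decodeTime_le_add_one_iff {a b : ℕ} :
    decodeTime a ≤ decodeTime b + 1 ↔ b = 0 ∨ (¬ a = 0 ∧ a ≤ b + 1) := by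
  rcases a with - | a <;> rcases b with - | b <;> simp [decodeTime]
  norm_cast

namespace GameCode

/-- The owner of a vertex in a coded game. -/
def ownerOf (g : GameCode) (w : ℕ) : ℕ := g.owners.getD w 0

/-- The edge relation of a coded game. -/
def hasEdge (g : GameCode) (w w' : ℕ) : Bool := (g.edges.getD w []).getD w' false

/-- The target sets of a coded game. -/
def isTarget (g : GameCode) (i w : ℕ) : Bool := (g.targets.getD i []).getD w false

end GameCode

/-- Codes of certificates: a machine, a list of labels, and a table of coded times. -/
abbrev CertCode : Type := MooreCode × List ℕ × List (List ℕ)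

namespace CertCode

/-- The transition function of a coded certificate. -/
def next (c : CertCode) (q w : ℕ) : ℕ := (c.1.step.getD q []).getD w 0

/-- The output function of a coded certificate. -/
def output (c : CertCode) (q : ℕ) : ℕ := c.1.out.getD q 0

/-- The labels of a coded certificate. -/
def label (c : CertCode) (q : ℕ) : ℕ := c.2.1.getD q 0

/-- The coded times of a coded certificate. -/
def time (c : CertCode) (q i : ℕ) : ℕ := (c.2.2.getD q []).getD i 0

/-- The tables of the certificate have the right sizes and entries in the right ranges. -/
def WellFormed (g : GameCode) (c : CertCode) : Prop :=
  c.1.states = c.1.init + 1 ∧ c.1.step.length = c.1.states ∧ c.1.out.length = c.1.states ∧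
    ∀ q < c.1.states, (c.1.step.getD q []).length = g.vertices ∧ c.output q < g.vertices ∧
      c.label q < g.vertices ∧ ∀ w < g.vertices, c.next q w < c.1.states

/-- The conditions on the first state after the initial one. -/
def StartValid (g : GameCode) (c : CertCode) : Prop :=
  c.next c.1.init g.start < c.1.init ∧ c.label (c.next c.1.init g.start) = g.start ∧
    ∀ i < g.players, c.time (c.next c.1.init g.start) i = 1 ↔ g.isTarget i g.start = true

/-- The conditions on the output of a state. -/
def OutputValid (g : GameCode) (c : CertCode) (q : ℕ) : Prop :=
  g.hasEdge (c.label q) (c.output q) = true ∧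
    ∀ i < g.players, c.time (c.next q (c.output q)) i = predTime (c.time q i)

/-- The conditions on the transition from the state `q` that reads `w`. -/
def StepValid (g : GameCode) (c : CertCode) (q w : ℕ) : Prop :=
  c.next q w < c.1.init ∧ c.label (c.next q w) = w ∧
    (c.time (c.next q w) (g.ownerOf (c.label q)) = 0 ∨
      (¬ c.time q (g.ownerOf (c.label q)) = 0 ∧ c.time q (g.ownerOf (c.label q)) ≤
        c.time (c.next q w) (g.ownerOf (c.label q)) + 1)) ∧
    ∀ i < g.players, c.time (c.next q w) i = 1 ↔ (c.time q i = 1 ∨ g.isTarget i w = true)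

/-- The coded certificate is a certificate for the coded game. -/
def Valid (g : GameCode) (c : CertCode) : Prop :=
  WellFormed g c ∧ StartValid g c ∧ ∀ q < c.1.init, OutputValid g c q ∧
    ∀ w < g.vertices, g.hasEdge (c.label q) w = true → StepValid g c q w

end CertCode

/-! ### Validity is primitive recursive -/

section Primrec

open Primrec

variable {α : Type*} [Primcodable α]

/-- All quantifiers in `CertCode.Valid` have bounds computable from the data; they become
quantifiers over the list `List.range`. -/
theorem _root_.PrimrecPred.forall_lt_of {p : α → ℕ → Prop} {b : α → ℕ} (hb : Primrec b)
    (hp : PrimrecPred fun y : α × ℕ => p y.1 y.2) : PrimrecPred fun a => ∀ n < b a, p a n :=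
  ((PrimrecRel.forall_mem_list (R := fun (n : ℕ) (a : α) => p a n)
    (hp.comp (Primrec.pair snd fst))).comp (list_range.comp hb) Primrec.id).of_eq
    fun _ => by simp

theorem _root_.PrimrecPred.imp {p q : α → Prop} (hp : PrimrecPred p) (hq : PrimrecPred q) :
    PrimrecPred fun a => p a → q a :=
  (hp.not.or hq).of_eq fun _ => imp_iff_not_or.symm

theorem _root_.PrimrecPred.iff {p q : α → Prop} (hp : PrimrecPred p) (hq : PrimrecPred q) :
    PrimrecPred fun a => p a ↔ q a :=
  ((hp.imp hq).and (hq.imp hp)).of_eq fun _ => iff_iff_implies_and_implies.symm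

theorem primrec_gameCode_equiv : Primrec GameCode.equiv := Primrec.of_equiv

theorem primrec_mooreCode_equiv : Primrec MooreCode.equiv := Primrec.of_equiv

variable {g : α → GameCode} {c : α → CertCode} {q w i : α → ℕ}

theorem primrec_players (hg : Primrec g) : Primrec fun a => (g a).players :=
  fst.comp (primrec_gameCode_equiv.comp hg)

theorem primrec_vertices (hg : Primrec g) : Primrec fun a => (g a).vertices :=
  fst.comp (snd.comp (primrec_gameCode_equiv.comp hg))

theorem primrec_start (hg : Primrec g) : Primrec fun a => (g a).start :=
  snd.comp (snd.comp (snd.comp (snd.comp (snd.comp (primrec_gameCode_equiv.comp hg)))))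

theorem primrec_getD_getD {β : Type*} [Primcodable β] {l : α → List (List β)} (hl : Primrec l)
    (hq : Primrec q) (hw : Primrec w) (d : β) :
    Primrec fun a => ((l a).getD (q a) []).getD (w a) d :=
  (list_getD d).comp ((list_getD []).comp hl hq) hw

theorem primrec_ownerOf (hg : Primrec g) (hw : Primrec w) :
    Primrec fun a => (g a).ownerOf (w a) :=
  (list_getD 0).comp (fst.comp (snd.comp (snd.comp (primrec_gameCode_equiv.comp hg)))) hw

theorem primrec_hasEdge (hg : Primrec g) (hq : Primrec q) (hw : Primrec w) :
    Primrec fun a => (g a).hasEdge (q a) (w a) :=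
  primrec_getD_getD (fst.comp (snd.comp (snd.comp (snd.comp (primrec_gameCode_equiv.comp hg)))))
    hq hw false

theorem primrec_isTarget (hg : Primrec g) (hi : Primrec i) (hw : Primrec w) :
    Primrec fun a => (g a).isTarget (i a) (w a) :=
  primrec_getD_getD
    (fst.comp (snd.comp (snd.comp (snd.comp (snd.comp (primrec_gameCode_equiv.comp hg))))))
    hi hw false

theorem primrec_states (hc : Primrec c) : Primrec fun a => (c a).1.states :=
  fst.comp (primrec_mooreCode_equiv.comp (fst.comp hc))

theorem primrec_init (hc : Primrec c) : Primrec fun a => (c a).1.init :=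
  fst.comp (snd.comp (primrec_mooreCode_equiv.comp (fst.comp hc)))

theorem primrec_step (hc : Primrec c) : Primrec fun a => (c a).1.step :=
  fst.comp (snd.comp (snd.comp (primrec_mooreCode_equiv.comp (fst.comp hc))))

theorem primrec_out (hc : Primrec c) : Primrec fun a => (c a).1.out :=
  snd.comp (snd.comp (snd.comp (primrec_mooreCode_equiv.comp (fst.comp hc))))

theorem primrec_next (hc : Primrec c) (hq : Primrec q) (hw : Primrec w) :
    Primrec fun a => (c a).next (q a) (w a) :=
  primrec_getD_getD (primrec_step hc) hq hw 0

theorem primrec_output (hc : Primrec c) (hq : Primrec q) :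
    Primrec fun a => (c a).output (q a) :=
  (list_getD 0).comp (primrec_out hc) hq

theorem primrec_label (hc : Primrec c) (hq : Primrec q) :
    Primrec fun a => (c a).label (q a) :=
  (list_getD 0).comp (fst.comp (snd.comp hc)) hq

theorem primrec_time (hc : Primrec c) (hq : Primrec q) (hi : Primrec i) :
    Primrec fun a => (c a).time (q a) (i a) :=
  primrec_getD_getD (snd.comp (snd.comp hc)) hq hi 0

theorem primrec_predTime (hq : Primrec q) : Primrec fun a => predTime (q a) :=
  Primrec.ite (nat_le.comp hq (Primrec.const 1)) hq (nat_sub.comp hq (Primrec.const 1))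

theorem primrecPred_eq_true {b : α → Bool} (hb : Primrec b) : PrimrecPred fun a => b a = true :=
  Primrec.eq.comp hb (Primrec.const true)

theorem primrecPred_wellFormed (hg : Primrec g) (hc : Primrec c) :
    PrimrecPred fun a => CertCode.WellFormed (g a) (c a) := by
  have hs := primrec_states hc
  have hv := primrec_vertices hg
  refine (Primrec.eq.comp hs (succ.comp (primrec_init hc))).and
    ((Primrec.eq.comp (list_length.comp (primrec_step hc)) hs).and
    ((Primrec.eq.comp (list_length.comp (primrec_out hc)) hs).and (.forall_lt_of hs ?_)))
  have hc' := hc.comp (fst (α := α) (β := ℕ))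
  have hv' := hv.comp (fst (α := α) (β := ℕ))
  refine (Primrec.eq.comp (list_length.comp ((list_getD []).comp (primrec_step hc') snd)) hv').and
    ((nat_lt.comp (primrec_output hc' snd) hv').and
    ((nat_lt.comp (primrec_label hc' snd) hv').and (.forall_lt_of hv' ?_)))
  exact nat_lt.comp (primrec_next (hc'.comp fst) (snd.comp fst) snd)
    (primrec_states (hc'.comp fst))

theorem primrecPred_startValid (hg : Primrec g) (hc : Primrec c) :
    PrimrecPred fun a => CertCode.StartValid (g a) (c a) := by
  have hi := primrec_init hc
  have hs := primrec_start hg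
  have hn := primrec_next hc hi hs
  exact (nat_lt.comp hn hi).and ((Primrec.eq.comp (primrec_label hc hn) hs).and
    (.forall_lt_of (primrec_players hg)
      ((Primrec.eq.comp (primrec_time (hc.comp fst) (hn.comp fst) snd) (Primrec.const 1)).iff
        (primrecPred_eq_true (primrec_isTarget (hg.comp fst) snd (hs.comp fst))))))

theorem primrecPred_outputValid (hg : Primrec g) (hc : Primrec c) (hq : Primrec q) :
    PrimrecPred fun a => CertCode.OutputValid (g a) (c a) (q a) := by
  have ho := primrec_output hc hq
  exact (primrecPred_eq_true (primrec_hasEdge hg (primrec_label hc hq) ho)).and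
    (.forall_lt_of (primrec_players hg) (Primrec.eq.comp
      (primrec_time (hc.comp fst) ((primrec_next hc hq ho).comp fst) snd)
      (primrec_predTime (primrec_time (hc.comp fst) (hq.comp fst) snd))))

theorem primrecPred_stepValid (hg : Primrec g) (hc : Primrec c) (hq : Primrec q)
    (hw : Primrec w) : PrimrecPred fun a => CertCode.StepValid (g a) (c a) (q a) (w a) := by
  have hn := primrec_next hc hq hw
  have ho := primrec_ownerOf hg (primrec_label hc hq)
  have ht := primrec_time hc hq ho
  have ht' := primrec_time hc hn ho
  refine (nat_lt.comp hn (primrec_init hc)).and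
    ((Primrec.eq.comp (primrec_label hc hn) hw).and (PrimrecPred.and ?_ ?_))
  · exact (Primrec.eq.comp ht' (Primrec.const 0)).or
      ((Primrec.eq.comp ht (Primrec.const 0)).not.and (nat_le.comp ht (succ.comp ht')))
  · refine .forall_lt_of (primrec_players hg) (PrimrecPred.iff ?_ (PrimrecPred.or ?_ ?_))
    · exact Primrec.eq.comp (primrec_time (hc.comp fst) (hn.comp fst) snd) (Primrec.const 1)
    · exact Primrec.eq.comp (primrec_time (hc.comp fst) (hq.comp fst) snd) (Primrec.const 1)
    · exact primrecPred_eq_true (primrec_isTarget (hg.comp fst) snd (hw.comp fst))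

theorem primrecPred_valid (hg : Primrec g) (hc : Primrec c) :
    PrimrecPred fun a => CertCode.Valid (g a) (c a) := by
  refine (primrecPred_wellFormed hg hc).and ((primrecPred_startValid hg hc).and
    (.forall_lt_of (primrec_init hc) (PrimrecPred.and ?_ ?_)))
  · exact primrecPred_outputValid (hg.comp fst) (hc.comp fst) snd
  · have hg' := (hg.comp (fst (α := α) (β := ℕ))).comp (fst (α := α × ℕ) (β := ℕ))
    have hc' := (hc.comp (fst (α := α) (β := ℕ))).comp (fst (α := α × ℕ) (β := ℕ))
    refine .forall_lt_of (primrec_vertices (hg.comp fst)) (PrimrecPred.imp ?_ ?_)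
    · exact primrecPred_eq_true
        (primrec_hasEdge hg' (primrec_label hc' (snd.comp fst)) snd)
    · exact primrecPred_stepValid hg' hc' (snd.comp fst) snd

end Primrec

/-! ### The search algorithm -/

open Classical in
/-- Search for a valid certificate, and return one copy of its machine for each player. -/
noncomputable def searchSPE : GameCode →. List MooreCode := fun g =>
  Nat.rfindOpt fun n => (Encodable.decode (α := CertCode) n).bind fun c =>
    if CertCode.Valid g c then some ((List.range g.players).map fun _ => c.1) else none

open Primrec in
theorem partrec_searchSPE : Partrec searchSPE := by
  classical
  refine Partrec.rfindOpt (Primrec.to_comp (option_bind (Primrec.decode.comp snd) ?_))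
  refine Primrec.ite (primrecPred_valid (fst.comp fst) snd) ?_ (Primrec.const none)
  exact option_some.comp (list_map (list_range.comp (primrec_players (fst.comp fst)))
    (fst.comp (snd.comp fst)))

/-! ### Correspondence between certificates and valid codes -/

section Code

variable {p n : ℕ} (G : ReachGame (Fin p) (Fin n)) (v₀ : Fin n)

theorem getD_ofFn {β : Type*} {n : ℕ} (f : Fin n → β) (i : Fin n) (d : β) :
    (List.ofFn f).getD i d = f i := by
  simp [List.getD]

theorem ownerOf_code (w : Fin n) : (G.code v₀).ownerOf w = G.owner w := by
  simp only [GameCode.ownerOf, ReachGame.code, getD_ofFn]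

theorem hasEdge_code (w w' : Fin n) : (G.code v₀).hasEdge w w' = true ↔ G.Edge w w' := by
  simp only [GameCode.hasEdge, ReachGame.code, getD_ofFn, decide_eq_true_eq]

theorem isTarget_code (i : Fin p) (w : Fin n) :
    (G.code v₀).isTarget i w = true ↔ w ∈ G.target i := by
  simp only [GameCode.isTarget, ReachGame.code, getD_ofFn, decide_eq_true_eq]

variable {G v₀}

/-- Soundness of the check. The exact table sizes in `WellFormed` are what makes the decoded machine
have precisely the given code. -/
theorem CertCode.Valid.exists_isCertificate {c : CertCode} (H : CertCode.Valid (G.code v₀) c) :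
    ∃ (m : MooreMachine (Fin n) (Fin c.1.states)) (good : Set (Fin c.1.states))
      (lab : Fin c.1.states → Fin n) (val : Fin c.1.states → Fin p → ℕ∞),
      m.code = c.1 ∧ IsCertificate G v₀ m good lab val := by
  obtain ⟨⟨h1, h2, h3, h4⟩, ⟨h5, h6, h7⟩, h8⟩ := H
  let m : MooreMachine (Fin n) (Fin c.1.states) :=
    { init := ⟨c.1.init, by omega⟩
      step := fun q w => ⟨c.next q w, (h4 q q.2).2.2.2 w w.2⟩
      out := fun q => ⟨c.output q, (h4 q q.2).2.1⟩ }
  let lab : Fin c.1.states → Fin n := fun q => ⟨c.label q, (h4 q q.2).2.2.1⟩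
  let val : Fin c.1.states → Fin p → ℕ∞ := fun q i => decodeTime (c.time q i)
  have edge {q w} (he : G.Edge (lab q) w) :
      (G.code v₀).hasEdge (c.label q) w = true := (hasEdge_code G v₀ (lab q) w).2 he
  refine ⟨m, {q | (q : ℕ) < c.1.init}, lab, val, ?_, ?_⟩
  · have hstep : (List.ofFn fun q => List.ofFn fun w => (m.step q w : ℕ)) = c.1.step := by
      refine List.ext_getElem (by simp [h2]) fun q hq hq' => ?_
      have hrow := (h4 q (by omega)).1
      rw [List.getD_eq_getElem _ _ hq'] at hrow
      refine List.ext_getElem (by simp [hrow, ReachGame.code]) fun w hw hw' => ?_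
      simp [m, CertCode.next, hq', hw']
    have hout : (List.ofFn fun q => (m.out q : ℕ)) = c.1.out := by
      refine List.ext_getElem (by simp [h3]) fun q hq hq' => ?_
      simp [m, CertCode.output, hq']
    change MooreCode.mk c.1.states c.1.init _ _ = c.1
    rw [hstep, hout]
  · constructor
    · exact h5
    · exact Fin.ext h6
    · intro i
      exact decodeTime_eq_zero_iff.trans ((h7 i i.2).trans (isTarget_code G v₀ i v₀))
    · intro q hq
      exact (hasEdge_code G v₀ (lab q) (m.out q)).1 (h8 q hq).1.1
    · intro q hq w he
      exact ((h8 q hq).2 w w.2 (edge he)).1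
    · intro q hq w he
      exact Fin.ext ((h8 q hq).2 w w.2 (edge he)).2.1
    · intro q hq w he i
      simp only [val, decodeTime_eq_zero_iff, ← isTarget_code G v₀]
      exact ((h8 q hq).2 w w.2 (edge he)).2.2.2 i i.2
    · intro q hq i
      simp only [val, ← decodeTime_predTime]
      exact congrArg _ ((h8 q hq).1.2 i i.2)
    · intro q hq w he
      have := ((h8 q hq).2 w w.2 (edge he)).2.2.1
      rw [← decodeTime_le_add_one_iff, ownerOf_code G v₀ (lab q)] at this
      exact this

/-- Completeness of the check, for certificates of the shape that `exists_isCertificate` produces: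
the initial state is the last one, and all others are good. -/
theorem IsCertificate.exists_valid {k : ℕ} {m : MooreMachine (Fin n) (Fin (k + 1))}
    {lab : Fin (k + 1) → Fin n} {val : Fin (k + 1) → Fin p → ℕ∞}
    (C : IsCertificate G v₀ m {q | (q : ℕ) < k} lab val) (hm : m.init = Fin.last k) :
    ∃ c, CertCode.Valid (G.code v₀) c := by
  -- Only the existence of a code matters here, so `enc` may be chosen nonconstructively.
  choose enc henc using decodeTime_surjective
  let c : CertCode := ⟨m.code, List.ofFn fun q => (lab q : ℕ),
    List.ofFn fun q => List.ofFn fun i => enc (val q i)⟩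
  have next_eq (q : Fin (k + 1)) (w : Fin n) : c.next q w = m.step q w := by
    simp only [c, CertCode.next, MooreMachine.code, getD_ofFn]
  have output_eq (q : Fin (k + 1)) : c.output q = m.out q := by
    simp only [c, CertCode.output, MooreMachine.code, getD_ofFn]
  have label_eq (q : Fin (k + 1)) : c.label q = lab q := by
    simp only [c, CertCode.label, getD_ofFn]
  have time_eq (q : Fin (k + 1)) (i : Fin p) : decodeTime (c.time q i) = val q i := by
    simp only [c, CertCode.time, getD_ofFn, henc]
  have init_eq : c.1.init = k := by simp [c, MooreMachine.code, hm]
  have init_eq' : c.1.init = m.init := rfl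
  have start_eq : (G.code v₀).start = v₀ := rfl
  refine ⟨c, ⟨?_, ?_, ?_, ?_⟩, ⟨?_, ?_, ?_⟩, ?_⟩
  · rw [init_eq]; rfl
  · simp [c, MooreMachine.code]
  · simp [c, MooreMachine.code]
  · intro q hq
    lift q to Fin (k + 1) using hq
    refine ⟨?_, ?_, ?_, fun w hw => ?_⟩
    · simp only [c, MooreMachine.code, getD_ofFn, List.length_ofFn]; rfl
    · rw [output_eq]; exact (m.out q).2
    · rw [label_eq]; exact (lab q).2
    · lift w to Fin n using hw
      rw [next_eq]; exact (m.step q w).2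
  · rw [init_eq', start_eq, next_eq, hm]
    simpa [hm] using C.start_mem
  · rw [init_eq', start_eq, next_eq, label_eq, C.lab_start]
  · intro i hi
    lift i to Fin p using hi
    rw [init_eq', start_eq, next_eq, ← decodeTime_eq_zero_iff, time_eq, isTarget_code]
    exact C.val_start i
  · intro q hq
    rw [init_eq] at hq
    obtain ⟨q, rfl⟩ : ∃ q' : Fin (k + 1), (q' : ℕ) = q := ⟨⟨q, by omega⟩, rfl⟩
    rw [CertCode.OutputValid, output_eq, label_eq, next_eq, hasEdge_code]
    refine ⟨⟨C.edge_out q hq, fun i hi => ?_⟩, fun w hw he => ?_⟩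
    · lift i to Fin p using hi
      rw [← decodeTime_injective.eq_iff, decodeTime_predTime, time_eq, time_eq]
      exact C.val_out q hq i
    · lift w to Fin n using hw
      rw [hasEdge_code] at he
      rw [CertCode.StepValid, next_eq, label_eq, label_eq, ownerOf_code,
        ← decodeTime_le_add_one_iff, time_eq, time_eq, init_eq]
      refine ⟨C.step_mem q hq w he, by rw [C.lab_step q hq w he], C.val_le q hq w he,
        fun i hi => ?_⟩
      lift i to Fin p using hi
      rw [← decodeTime_eq_zero_iff, ← decodeTime_eq_zero_iff, time_eq, time_eq, isTarget_code]
      exact C.val_step q hq w he i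

end Code

/-- Completeness makes the search halt and soundness makes its result correct. One machine serves
all players, since a player's strategy is tested only at his own vertices. -/
theorem constructsSPE_searchSPE : ConstructsSPE searchSPE := by
  classical
  intro p n G v₀
  obtain ⟨k, m, lab, val, hm, C⟩ := G.exists_isCertificate v₀
  obtain ⟨c, hc⟩ := C.exists_valid hm
  have hdom : (searchSPE (G.code v₀)).Dom :=
    Nat.rfindOpt_dom.2 ⟨Encodable.encode c, _, by simp [hc]; rfl⟩
  obtain ⟨l, hl⟩ := Part.dom_iff_mem.1 hdom
  -- The certificate `c'` found by the search need not be `c`; only its validity is used.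
  obtain ⟨N, hN⟩ := Nat.rfindOpt_spec hl
  obtain ⟨c', -, hc'⟩ := Option.bind_eq_some_iff.1 hN
  split_ifs at hc' with hv
  obtain rfl := Option.some.inj hc'
  obtain ⟨m', good', lab', val', hcode, C'⟩ := hv.exists_isCertificate
  refine ⟨fun _ => c'.1.states, fun _ => m', C'.profile, ?_, C'.implements_profile,
    C'.isSPE_profile⟩
  have hlist : (List.ofFn fun _ : Fin p => m'.code) =
      (List.range (G.code v₀).players).map fun _ => c'.1 := by
    rw [hcode, List.ofFn_const, List.map_const', List.length_range]
    rfl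
  exact hlist ▸ hl

end QuantReach

theorem theorem4p3 :
    (∀ (P : Type*) (V : Type*) [Finite P] [Finite V] (G : QuantReach.ReachGame P V) (v₀ : V),
      ∃ σ : G.toQuantGame.toArena.Profile v₀,
        σ.IsFiniteMemory ∧ G.toQuantGame.IsSPE v₀ σ) ∧
    (∃ f : QuantReach.GameCode →. List QuantReach.MooreCode,
      Partrec f ∧ QuantReach.ConstructsSPE f) :=
  ⟨fun _ _ _ _ G v₀ => G.exists_finiteMemory_isSPE v₀,
    QuantReach.searchSPE, QuantReach.partrec_searchSPE, QuantReach.constructsSPE_searchSPE⟩
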